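/- Let $(M,g)$ be an oriented Riemannian surface with a spin structure, let $H:M\to\mathbb{R}$ be a differentiable function and let $\tau\in\mathbb{R}$. Let $\Sigma M$ be the (complex, rank two) spinor bundle, with its natural Hermitian norm, Clifford multiplication $X\cdot X\cdot\psi=-|X|^2\psi$, the spinorial Levi-Civita connection $\nabla$, and the Dirac operator $D\psi=e_1\cdot\nabla_{e_1}\psi+e_2\cdot\nabla_{e_2}\psi$, where $(e_1,e_2)$ is a positively oriented orthonormal frame. Put $\omega=e_1\cdot e_2$, and let $\psi=\psi^++\psi^-$ be the decomposition of a spinor into its components in the eigenbundles $\Sigma^{\pm}M$ of $\psi\mapsto i\,\omega\cdot\psi$ for the eigenvalues $\pm1$. Consider the following data: (1) a smooth section $\psi$ of $\Sigma M$ with $|\psi^+|^2-|\psi^-|^2=1$ that solves the Dirac equation $$D\psi=-iH\psi+i\tau\,\omega\cdot\psi;$$ (2) a pair $(\psi,S)$ of a smooth section $\psi$ of $\Sigma M$ and a smooth field $S:TM\to TM$ of symmetric operators such that $H=\tfrac12\operatorname{tr}S$, $|\psi^+|^2-|\psi^-|^2=1$, and $$\nabla_X\psi=\frac{i}{2}S(X)\cdot\psi-\frac{i}{2}\tau\,X\cdot\omega\cdot\psi\qquad\text{for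 all }X\in TM.$$ Then $(\psi,S)\mapsto\psi$ is a bijection from the data (2) onto the data (1). That is, if $(\psi,S)$ is as in (2) then $\psi$ is as in (1), and for every $\psi$ as in (1) there is exactly one $S$ such that $(\psi,S)$ is as in (2). -/

import Mathlib

open Bundle Manifold VectorField
open scoped ContDiff

noncomputable section

namespace SpinSurface

/-! ### The Clifford algebra of the Euclidean plane and its spin group -/

/-- The real Clifford algebra of the Euclidean plane (vectors satisfy `v * v = -|v| ^ 2`), in its
standard model, the quaternions `q₀ + q₁ I + q₂ J + q₃ K`. -/
abbrev Cl : Type := Quaternion ℝ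

/-- The quaternion `I`. -/
def Cl.I : Cl := ⟨0, 1, 0, 0⟩

/-- The quaternion `J`. -/
def Cl.J : Cl := ⟨0, 0, 1, 0⟩

/-- The images `ε₁ = J` and `ε₂ = J I` in the Clifford algebra of the standard basis of the
plane. -/
def Cl.gen : Fin 2 → Cl := ![Cl.J, Cl.J * Cl.I]

/-- The Clifford relation `v * v = -|v| ^ 2` for `v = a ε₁ + b ε₂`. -/
theorem Cl.sq_eq (a b : ℝ) :
    (a • Cl.gen 0 + b • Cl.gen 1) * (a • Cl.gen 0 + b • Cl.gen 1)
      = ((-(a ^ 2 + b ^ 2) : ℝ) : Cl) := by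
  have hI : Cl.I.re = 0 ∧ Cl.I.imI = 1 ∧ Cl.I.imJ = 0 ∧ Cl.I.imK = 0 := ⟨rfl, rfl, rfl, rfl⟩
  have hJ : Cl.J.re = 0 ∧ Cl.J.imI = 0 ∧ Cl.J.imJ = 1 ∧ Cl.J.imK = 0 := ⟨rfl, rfl, rfl, rfl⟩
  have h0 : Cl.gen 0 = Cl.J := rfl
  have h1 : Cl.gen 1 = Cl.J * Cl.I := rfl
  rw [h0, h1]
  ext <;> simp [-Quaternion.coe_neg, -Quaternion.coe_add, -Quaternion.coe_pow, hI, hJ] <;> ring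

/-- The group `Spin(2) = {q₀ + q₁ I : q₀ ^ 2 + q₁ ^ 2 = 1}`. -/
def Cl.spin : Set Cl := {q | q.imJ = 0 ∧ q.imK = 0 ∧ Quaternion.normSq q = 1}

/-! ### Surfaces -/

/-- The Euclidean plane, on which surfaces are modelled. -/
abbrev E2 : Type := EuclideanSpace ℝ (Fin 2)

variable {M : Type*} [TopologicalSpace M] [ChartedSpace E2 M]

/-- The tangent plane of a surface at a point. -/
abbrev T (x : M) : Type := TangentSpace (𝓡 2) x

/-- The vectors `v₀, v₁` form a basis that is positive for the orientation `o`. -/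
def IsPositiveBasis {V : Type*} [AddCommGroup V] [Module ℝ V] (o : Orientation ℝ V (Fin 2))
    (v : Fin 2 → V) : Prop :=
  ∃ b : Module.Basis (Fin 2) ℝ V, ⇑b = v ∧ b.orientation = o

variable (M) in
/-- An orientation of the surface `M`: an orientation of every tangent plane such that every point
has a neighbourhood that carries a smooth positive frame. -/
structure SurfaceOrientation [IsManifold (𝓡 2) ∞ M] where
  orientation : ∀ x : M, Orientation ℝ (T x) (Fin 2)
  exists_frame : ∀ x : M, ∃ U : Set M, IsOpen U ∧ x ∈ U ∧ ∃ e : Fin 2 → ∀ y : M, T y,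
    (∀ j, ContMDiffOn (𝓡 2) ((𝓡 2).prod 𝓘(ℝ, E2)) ∞
      (fun y ↦ (⟨y, e j y⟩ : TangentBundle (𝓡 2) M)) U) ∧
    ∀ y ∈ U, IsPositiveBasis (orientation y) (fun j ↦ e j y)

section Riemannian

variable [RiemannianBundle (fun x : M ↦ T x)]

/-- The Levi-Civita connection: `leviCivita X Y Z x` is the value at `x` of `g(∇_X Y, Z)`, given by
the Koszul formula. -/
def leviCivita (X Y Z : ∀ x : M, T x) (x : M) : ℝ :=
  (1 / 2) * (mvfderiv (𝓡 2) (fun y ↦ inner ℝ (Y y) (Z y)) x (X x)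
    + mvfderiv (𝓡 2) (fun y ↦ inner ℝ (X y) (Z y)) x (Y x)
    - mvfderiv (𝓡 2) (fun y ↦ inner ℝ (X y) (Y y)) x (Z x)
    + inner ℝ (mlieBracket (𝓡 2) X Y x) (Z x)
    - inner ℝ (mlieBracket (𝓡 2) X Z x) (Y x)
    - inner ℝ (mlieBracket (𝓡 2) Y Z x) (X x))

/-- `leviCivita` is metric. -/
theorem leviCivita_add_swap (X Y Z : ∀ x : M, T x) (x : M) :
    leviCivita X Y Z x + leviCivita X Z Y x
      = mvfderiv (𝓡 2) (fun y ↦ inner ℝ (Y y) (Z y)) x (X x) := by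
  have h1 : mlieBracket (𝓡 2) Z Y x = -mlieBracket (𝓡 2) Y Z x := mlieBracket_swap_apply
  have h2 : (fun y ↦ inner ℝ (Z y) (Y y)) = fun y ↦ inner ℝ (Y y) (Z y) :=
    funext fun y ↦ real_inner_comm _ _
  simp only [leviCivita, h1, h2, inner_neg_left]
  ring

/-- `leviCivita` is torsion free. -/
theorem leviCivita_sub_swap (X Y Z : ∀ x : M, T x) (x : M) :
    leviCivita X Y Z x - leviCivita Y X Z x = inner ℝ (mlieBracket (𝓡 2) X Y x) (Z x) := by
  have h1 : mlieBracket (𝓡 2) Y X x = -mlieBracket (𝓡 2) X Y x := mlieBracket_swap_apply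
  have h2 : (fun y ↦ inner ℝ (Y y) (X y)) = fun y ↦ inner ℝ (X y) (Y y) :=
    funext fun y ↦ real_inner_comm _ _
  simp only [leviCivita, h1, h2, inner_neg_left]
  ring

/-- The Clifford element `⟨X, e₁⟩ ε₁ + ⟨X, e₂⟩ ε₂` of the tangent vector `X` with respect to an
orthonormal basis `(e₁, e₂)` of the tangent plane. -/
def vec {x : M} (e : Fin 2 → T x) (X : T x) : Cl :=
  ∑ j, (inner ℝ (e j) X : ℝ) • Cl.gen j

/-! ### Spin structures -/

variable [IsManifold (𝓡 2) ∞ M]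

/-- A spin structure on an oriented Riemannian surface, i.e. a principal `Spin(2)`-bundle `Q` that
is an equivariant double cover of the bundle of positive orthonormal frames, given by its
transition functions: `Q` has local sections `sₐ` over the open sets `baseSet a` (which cover `M`),
lying over smooth positive orthonormal frames `frame a`, and `s_b = s_a · trans a b` where
`trans a b` takes values in `Spin(2)`. -/
structure SpinStructure (o : SurfaceOrientation M) (ι : Type*) where
  baseSet : ι → Set M
  isOpen_baseSet : ∀ a, IsOpen (baseSet a)
  indexAt : M → ι
  mem_baseSet_at : ∀ x, x ∈ baseSet (indexAt x)
  frame : ι → Fin 2 → ∀ x : M, T x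
  contMDiffOn_frame : ∀ a j, ContMDiffOn (𝓡 2) ((𝓡 2).prod 𝓘(ℝ, E2)) ∞
    (fun x ↦ (⟨x, frame a j x⟩ : TangentBundle (𝓡 2) M)) (baseSet a)
  orthonormal_frame : ∀ a, ∀ x ∈ baseSet a, Orthonormal ℝ (fun j ↦ frame a j x)
  positive_frame : ∀ a, ∀ x ∈ baseSet a,
    IsPositiveBasis (o.orientation x) (fun j ↦ frame a j x)
  trans : ι → ι → M → Cl
  contMDiffOn_trans : ∀ a b, ContMDiffOn (𝓡 2) 𝓘(ℝ, Cl) ∞ (trans a b) (baseSet a ∩ baseSet b)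
  trans_mem : ∀ a b, ∀ x ∈ baseSet a ∩ baseSet b, trans a b x ∈ Cl.spin
  trans_self : ∀ a, ∀ x ∈ baseSet a, trans a a x = 1
  trans_mul_trans : ∀ a b c, ∀ x ∈ baseSet a ∩ baseSet b ∩ baseSet c,
    trans a b x * trans b c x = trans a c x
  /-- The frames change by the double cover `Ad : Spin(2) → SO(2)`: one has
  `vecₐ(X) = g · vec_b(X) · g⁻¹` with `g = trans a b`. -/
  vec_mul_trans : ∀ a b, ∀ x ∈ baseSet a ∩ baseSet b, ∀ X : T x,
    vec (fun j ↦ frame a j x) X * trans a b x = trans a b x * vec (fun j ↦ frame b j x) X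

namespace SpinStructure

variable {o : SurfaceOrientation M} {ι : Type*} (Q : SpinStructure o ι)

/-- The spinor bundle `ΣM = Q ×_ρ Cl`, where `ρ` is the representation of `Spin(2)` on `Cl` by
left multiplication: `[s_a, q]` and `[s_b, r]` are identified when `q = trans a b * r`. -/
def core : VectorBundleCore ℝ M Cl ι where
  baseSet := Q.baseSet
  isOpen_baseSet := Q.isOpen_baseSet
  indexAt := Q.indexAt
  mem_baseSet_at := Q.mem_baseSet_at
  coordChange a b x := ContinuousLinearMap.mul ℝ Cl (Q.trans b a x)
  coordChange_self a x hx v := by simp [Q.trans_self a x hx]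
  continuousOn_coordChange a b :=
    (ContinuousLinearMap.mul ℝ Cl).continuous.comp_continuousOn
      ((Q.contMDiffOn_trans b a).continuousOn.mono fun _ hx ↦ ⟨hx.2, hx.1⟩)
  coordChange_comp a b c x hx v := by
    simp [← mul_assoc, Q.trans_mul_trans c b a x ⟨⟨hx.2, hx.1.2⟩, hx.1.1⟩]

instance : Q.core.IsContMDiff (𝓡 2) ∞ where
  contMDiffOn_coordChange a b :=
    (ContinuousLinearMap.mul ℝ Cl).contMDiff.comp_contMDiffOn
      ((Q.contMDiffOn_trans b a).mono fun _ hx ↦ ⟨hx.2, hx.1⟩)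

/-- The fibre of the spinor bundle `ΣM` at a point. -/
abbrev SpinorBundle : M → Type := Q.core.Fiber

/-- Smooth spinor fields, the elements of `Γ(ΣM)`. -/
abbrev SpinorField : Type _ := ContMDiffSection (𝓡 2) Cl ∞ Q.SpinorBundle

/-- The coordinate `q` of a spinor `ψ = [sₐ, q]`. -/
def coord (a : ι) {x : M} (ψ : Q.SpinorBundle x) : Cl := (Q.core.localTriv a ⟨x, ψ⟩).2

/-- The spinor `[sₐ, q]` at `x`. -/
def ofCoord (a : ι) (x : M) (q : Cl) : Q.SpinorBundle x := (Q.core.localTriv a).symm x q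

/-- The orthonormal frame over which the preferred section of `Q` near `x` lies. -/
def frameAt (x : M) (j : Fin 2) : T x := Q.frame (Q.indexAt x) j x

/-- Clifford multiplication `X · ψ`, i.e. `X · [s, q] = [s, vec(X) q]`. -/
def clifford {x : M} (X : T x) (ψ : Q.SpinorBundle x) : Q.SpinorBundle x :=
  Q.ofCoord (Q.indexAt x) x (vec (Q.frameAt x) X * Q.coord (Q.indexAt x) ψ)

/-- The complex structure `ψ ↦ i ψ` of the spinor bundle: right multiplication by `I`. -/
def iMul {x : M} (ψ : Q.SpinorBundle x) : Q.SpinorBundle x :=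
  Q.ofCoord (Q.indexAt x) x (Q.coord (Q.indexAt x) ψ * Cl.I)

/-- `|ψ|²`, for the natural Hermitian product of the spinor bundle. -/
def normSq {x : M} (ψ : Q.SpinorBundle x) : ℝ := Quaternion.normSq (Q.coord (Q.indexAt x) ψ)

/-- `ω · ψ`, where `ω = e₁ · e₂` for a positive orthonormal basis `(e₁, e₂)`. -/
def omega {x : M} (ψ : Q.SpinorBundle x) : Q.SpinorBundle x :=
  Q.clifford (Q.frameAt x 0) (Q.clifford (Q.frameAt x 1) ψ)

/-- `ψ⁺`, the component of `ψ` in `Σ⁺M`, the `+1`-eigenbundle of `ψ ↦ i ω · ψ`. -/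
def plus {x : M} (ψ : Q.SpinorBundle x) : Q.SpinorBundle x :=
  (1 / 2 : ℝ) • (ψ + Q.iMul (Q.omega ψ))

/-- `ψ⁻`, the component of `ψ` in `Σ⁻M`, the `-1`-eigenbundle of `ψ ↦ i ω · ψ`. -/
def minus {x : M} (ψ : Q.SpinorBundle x) : Q.SpinorBundle x :=
  (1 / 2 : ℝ) • (ψ - Q.iMul (Q.omega ψ))

/-- The connection form `X ↦ g(∇_X e₁, e₂)` of the frame `(e₁, e₂) = frame a`. -/
def connectionForm (a : ι) {x : M} (X : T x) : ℝ :=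
  ∑ j, inner ℝ (Q.frame a j x) X * leviCivita (Q.frame a j) (Q.frame a 0) (Q.frame a 1) x

/-- The spinorial Levi-Civita connection: if `ψ = [s, q]` near `x`, then
`∇_X ψ = [s, dq(X) + ½ g(∇_X e₁, e₂) ε₁ ε₂ q]`. -/
def nabla (ψ : ∀ x, Q.SpinorBundle x) {x : M} (X : T x) : Q.SpinorBundle x :=
  Q.ofCoord (Q.indexAt x) x
    (mvfderiv (𝓡 2) (fun y ↦ Q.coord (Q.indexAt x) (ψ y)) x X
      + (1 / 2 * Q.connectionForm (Q.indexAt x) X) •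
          (Cl.gen 0 * Cl.gen 1 * Q.coord (Q.indexAt x) (ψ x)))

/-- The Dirac operator `D ψ = e₁ · ∇_{e₁} ψ + e₂ · ∇_{e₂} ψ`. -/
def dirac (ψ : ∀ x, Q.SpinorBundle x) (x : M) : Q.SpinorBundle x :=
  ∑ j, Q.clifford (Q.frameAt x j) (Q.nabla ψ (Q.frameAt x j))

end SpinStructure

variable (M) in
/-- Smooth fields of endomorphisms `S : TM → TM`. -/
abbrev EndoField : Type _ :=
  ContMDiffSection (𝓡 2) (E2 →L[ℝ] E2) ∞ (fun x : M ↦ T x →L[ℝ] T x)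

variable {o : SurfaceOrientation M} {ι : Type*}

/-- The spinor fields `ψ` with `|ψ⁺|² - |ψ⁻|² = 1` and `D ψ = - i H ψ + i τ ω · ψ`. -/
def diracData (Q : SpinStructure o ι) (H : M → ℝ) (τ : ℝ) : Set Q.SpinorField :=
  {ψ | (∀ x, Q.normSq (Q.plus (ψ x)) - Q.normSq (Q.minus (ψ x)) = 1) ∧
    ∀ x, Q.dirac ψ x = -(H x • Q.iMul (ψ x)) + τ • Q.iMul (Q.omega (ψ x))}

/-- The pairs `(ψ, S)` with `S` symmetric, `H = ½ tr S`, `|ψ⁺|² - |ψ⁻|² = 1` and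
`∇_X ψ = (i/2) S(X) · ψ - (i/2) τ X · ω · ψ`. -/
def killingData (Q : SpinStructure o ι) (H : M → ℝ) (τ : ℝ) : Set (Q.SpinorField × EndoField M) :=
  {p | (∀ x, ∀ X Y : T x, inner ℝ (p.2 x X) Y = inner ℝ X (p.2 x Y)) ∧
    (∀ x, H x = (1 / 2) * LinearMap.trace ℝ (T x) (p.2 x : T x →ₗ[ℝ] T x)) ∧
    (∀ x, ∀ X : T x, Q.nabla p.1 X =
      (1 / 2 : ℝ) • Q.iMul (Q.clifford (p.2 x X) (p.1 x))
        - (τ / 2) • Q.iMul (Q.clifford X (Q.omega (p.1 x)))) ∧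
    ∀ x, Q.normSq (Q.plus (p.1 x)) - Q.normSq (Q.minus (p.1 x)) = 1}

end Riemannian

end SpinSurface

end

/-!
All computations take place in a gauge, i.e. in a local section of the spin structure: a spinor
becomes a quaternion `q`, Clifford multiplication by a vector is left multiplication by an element
of the plane spanned by `J` and `K`, `ω` acts as left multiplication by `-I`, and `i` acts as right
multiplication by `I`. The function `|ψ⁺|² - |ψ⁻|²` is the quadratic form `Cl.form q`.

From the equation for `∇ ψ` the Dirac equation follows by contraction, as
`∑ e_j · S e_j = -tr S` for symmetric `S` (`dirac_of_killing`), and `S` is unique since Clifford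
multiplication of a nonzero spinor is injective (`eq_of_killing`).

Conversely, let `ψ` be a normalized solution of the Dirac equation. The equation to be solved for
`S X` has the only candidate `-(2 / |q|²) (∇_X q) I q̄ - τ vec(X) I` in the Clifford algebra, and the
point is that this element has no components along `1` and `I`. Differentiating the normalization
shows that the `I`-component of `(∇_X q) I q̄` vanishes (`pair_nabla_imI`). The Dirac equation,
multiplied by `I q̄` from the right, consists of four real equations: two of them make the real part
of `(∇_X q) I q̄` vanish, and the other two say that `S` is symmetric and has trace `2 H`
(`Cl.dirac_pair`).

It remains to see that `S` is smooth. The connection form contributes to `∇_X q` a multiple of `I q`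
only, and as the real part of `(∇_X q) I q̄` vanishes, this multiple is determined by `dq(X)`:
`∇_X q` is equal to `Cl.red q (dq(X))`, an expression in which the connection form does not occur.
So `S` is given by a formula that is smooth in `q` and `dq` (`contMDiffAt_shapeEndo`), and that a
change of gauge respects (`shapeEndo_eq`), because a change of gauge, too, alters `dq(X)` by a
multiple of `I q`. No regularity or transformation law of the connection form is needed.
-/

noncomputable section

namespace SpinSurface

/-! ### Algebra of the gauge representation -/

namespace Cl

@[simp] theorem I_re : I.re = 0 := rfl
@[simp] theorem I_imI : I.imI = 1 := rfl
@[simp] theorem I_imJ : I.imJ = 0 := rfl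
@[simp] theorem I_imK : I.imK = 0 := rfl
@[simp] theorem J_re : J.re = 0 := rfl
@[simp] theorem J_imI : J.imI = 0 := rfl
@[simp] theorem J_imJ : J.imJ = 1 := rfl
@[simp] theorem J_imK : J.imK = 0 := rfl

@[simp] theorem one_re : (1 : Cl).re = 1 := rfl
@[simp] theorem one_imI : (1 : Cl).imI = 0 := rfl
@[simp] theorem one_imJ : (1 : Cl).imJ = 0 := rfl
@[simp] theorem one_imK : (1 : Cl).imK = 0 := rfl

theorem gen_zero : gen 0 = J := rfl
theorem gen_one : gen 1 = J * I := rfl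

theorem I_mul_I : I * I = -1 := by
  ext <;> simp

theorem gen_mul_gen : gen 0 * gen 1 = -I := by
  rw [gen_zero, gen_one]
  ext <;> simp

/-- The quaternion `p i q̄`. If `q` represents a spinor `ψ` and `p` a spinor `φ`, its components are
real inner products: `re` is `⟨i φ, ψ⟩`, and `imI` is the polarization at `(φ, ψ)` of
`|ψ⁺|² - |ψ⁻|²`; the components `imJ` and `imK` are those that a tangent vector can have. -/
def pair (p q : Cl) : Cl := p * I * star q

/-- The quadratic form `|ψ⁺|² - |ψ⁻|²` in terms of the coordinate `q` of `ψ`. -/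
def form (q : Cl) : ℝ := (pair q q).imI

theorem form_eq (q : Cl) : form q = q.re ^ 2 + q.imI ^ 2 - q.imJ ^ 2 - q.imK ^ 2 := by
  simp [form, pair]; ring

theorem normSq_ne_zero {q : Cl} (hq : form q = 1) : Quaternion.normSq q ≠ 0 := by
  rintro h
  rw [Quaternion.normSq_def'] at h
  rw [form_eq] at hq
  nlinarith [sq_nonneg q.re, sq_nonneg q.imI, sq_nonneg q.imJ, sq_nonneg q.imK]

theorem star_mul_self_of_mem_spin {g : Cl} (hg : g ∈ spin) : star g * g = 1 := by
  rw [Quaternion.star_mul_self, hg.2.2]; rfl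

theorem I_comm {g : Cl} (hg : g ∈ spin) : I * g = g * I := by
  ext <;> simp [hg.1, hg.2.1]

theorem pair_mul (g p q : Cl) : pair (g * p) (g * q) = g * pair p q * star g := by
  simp [pair, mul_assoc]

theorem form_mul {g : Cl} (hg : g ∈ spin) (q : Cl) : form (g * q) = form q := by
  obtain ⟨hJ, hK, hn⟩ := hg
  rw [Quaternion.normSq_def', hJ, hK] at hn
  simp only [form_eq, Quaternion.re_mul, Quaternion.imI_mul, Quaternion.imJ_mul,
    Quaternion.imK_mul, hJ, hK]
  linear_combination (q.re ^ 2 + q.imI ^ 2 - q.imJ ^ 2 - q.imK ^ 2) * hn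

theorem pair_I_mul_re (q : Cl) : (pair (I * q) q).re = -form q := by
  simp [form_eq, pair]; ring

theorem pair_I_mul_imI (q : Cl) : (pair (I * q) q).imI = 0 := by
  simp [pair]; ring

theorem pair_re_mul {g : Cl} (hg : g ∈ spin) (p q : Cl) :
    (pair (g * p) (g * q)).re = (pair p q).re := by
  obtain ⟨hJ, hK, hn⟩ := hg
  rw [Quaternion.normSq_def', hJ, hK] at hn
  rw [pair_mul]
  simp only [Quaternion.re_mul, Quaternion.imI_mul, Quaternion.imJ_mul,
    Quaternion.imK_mul, Quaternion.re_star, Quaternion.imI_star, Quaternion.imJ_star,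
    Quaternion.imK_star, hJ, hK]
  linear_combination (pair p q).re * hn

theorem pair_add (p p' q : Cl) : pair (p + p') q = pair p q + pair p' q := by
  simp [pair, add_mul]

theorem pair_smul (c : ℝ) (p q : Cl) : pair (c • p) q = c • pair p q := by
  simp [pair]

theorem pair_mul_I (p q : Cl) : pair p q * q * I = -(Quaternion.normSq q • p) := by
  have h : star q * q = ((Quaternion.normSq q : ℝ) : Cl) := Quaternion.star_mul_self q
  rw [pair, mul_assoc _ (star q), h, ← Quaternion.coe_commutes, Quaternion.coe_mul_eq_smul,
    smul_mul_assoc, mul_assoc, I_mul_I, mul_neg_one, smul_neg]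

/-- The coordinate derivative `p = dq(X)` of a spinor field, corrected by the multiple of `I q` that
makes `⟨p i, q⟩` vanish when `form q = 1`. The connection form contributes a multiple of `I q` to the
covariant derivative, and so does a change of gauge to `p`; both are removed by the correction. -/
def red (q p : Cl) : Cl := p + (pair p q).re • (I * q)

theorem red_add (q p p' : Cl) : red q (p + p') = red q p + red q p' := by
  simp [red, pair_add, add_smul]; abel

theorem red_smul (c : ℝ) (q p : Cl) : red q (c • p) = c • red q p := by
  simp [red, pair_smul, mul_smul]

theorem red_I_mul {q : Cl} (hq : form q = 1) : red q (I * q) = 0 := by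
  simp [red, pair_I_mul_re, hq]

theorem red_mul {g : Cl} (hg : g ∈ spin) (q p : Cl) : red (g * q) (g * p) = g * red q p := by
  simp [red, pair_re_mul hg, mul_add, ← mul_assoc, I_comm hg]

/-- The projection of the Clifford algebra onto the plane spanned by `J` and `K`, i.e. onto the
Clifford elements that come from tangent vectors. -/
def proj (v : Cl) : Cl := (1 / 2 : ℝ) • (v + I * v * I)

theorem proj_eq (v : Cl) : proj v = v.imJ • gen 0 + (-v.imK) • gen 1 := by
  rw [gen_zero, gen_one, proj]
  ext <;> simp <;> ring

/-- `proj` commutes with conjugation by elements of `Spin(2)`, as these commute with `I`. -/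
theorem proj_mul {g v w : Cl} (hg : g ∈ spin) (h : v * g = g * w) : proj v * g = g * proj w := by
  have h2 : I * v * I * g = g * (I * w * I) := by
    rw [mul_assoc _ I g, I_comm hg, ← mul_assoc, mul_assoc I v g, h, ← mul_assoc, I_comm hg]
    simp only [mul_assoc]
  simp [proj, add_mul, mul_add, h, h2]

/-- The Clifford element `v` with `v q i = 2 red q p - τ w i q i`: when `p` is the derivative of a
spinor field in the direction `X` and `w = vec X`, it is the one that has to represent `S X`. -/
def shape (τ : ℝ) (q p w : Cl) : Cl :=
  -(2 / Quaternion.normSq q) • pair (red q p) q - τ • (w * I)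

theorem shape_mul_mul_I {τ : ℝ} {q p w : Cl} (hq : Quaternion.normSq q ≠ 0) :
    shape τ q p w * q * I = (2 : ℝ) • red q p - τ • (w * I * q * I) := by
  simp only [shape, sub_mul, smul_mul_assoc, pair_mul_I, smul_neg, neg_smul, neg_neg, neg_mul,
    smul_smul, div_mul_cancel₀ _ hq]

/-- `shape` is covariant under the change of gauge `q ↦ g q`, in which the derivative of `g`
contributes the multiple `c` of `I g q` to the derivative of the spinor. -/
theorem shape_mul {τ : ℝ} {g q p p' w w' : Cl} (c : ℝ) (hg : g ∈ spin) (hq : form q = 1)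
    (hp : p' = g * p + c • (I * (g * q))) (hw : w' * g = g * w) :
    shape τ (g * q) p' w' * g = g * shape τ q p w := by
  have hq' : form (g * q) = 1 := by rw [form_mul hg, hq]
  have h1 : pair (red (g * q) p') (g * q) * g = g * pair (red q p) q := by
    rw [hp, red_add, red_smul, red_I_mul hq', smul_zero, add_zero, red_mul hg, pair_mul, mul_assoc,
      star_mul_self_of_mem_spin hg, mul_one]
  have h2 : w' * I * g = g * (w * I) := by rw [mul_assoc, I_comm hg, ← mul_assoc, hw, mul_assoc]
  simp only [shape, sub_mul, mul_sub, smul_mul_assoc, mul_smul_comm, h1, h2, map_mul, hg.2.2,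
    one_mul]

/-- The derivative of `form`, in terms of its polarization `(pair p q).imI`. -/
theorem exists_hasFDerivAt_form (q : Cl) : ∃ f : Cl →L[ℝ] ℝ, HasFDerivAt form f q ∧
    ∀ p, f p = 2 * (pair p q).imI := by
  let L : Cl →L[ℝ] ℝ := LinearMap.toContinuousLinearMap
    { toFun := fun q : Cl ↦ q.imI
      map_add' := fun _ _ ↦ rfl
      map_smul' := fun _ _ ↦ rfl }
  let S : Cl →L[ℝ] Cl := LinearMap.toContinuousLinearMap
    { toFun := star
      map_add' := star_add
      map_smul' := Quaternion.star_smul }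
  have h := L.hasFDerivAt.comp q (((hasFDerivAt_id q).mul_const' I).mul' S.hasFDerivAt)
  refine ⟨_, h, fun p ↦ ?_⟩
  have hL : ∀ q, L q = q.imI := fun _ ↦ rfl
  have hS : ∀ q, S q = star q := fun _ ↦ rfl
  simp [hL, hS, pair]
  ring

theorem shape_sum {α : Type*} (s : Finset α) (τ : ℝ) (q : Cl) (c : α → ℝ) (p w : α → Cl) :
    shape τ q (∑ j ∈ s, c j • p j) (∑ j ∈ s, c j • w j) = ∑ j ∈ s, c j • shape τ q (p j) (w j) := by
  classical
  induction s using Finset.induction_on with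
  | empty =>
    simp only [Finset.sum_empty, shape, red, pair, zero_mul, smul_zero, sub_zero, zero_add,
      Quaternion.re_zero, zero_smul]
  | insert j s hj ih =>
    rw [Finset.sum_insert hj, Finset.sum_insert hj, Finset.sum_insert hj, ← ih]
    simp only [shape, red_add, red_smul, pair_add, pair_smul, add_mul, smul_add, smul_sub,
      smul_mul_assoc, smul_comm (c j)]
    abel

/-- The coordinates of a Clifford element with respect to the images `ε₁ = J` and `ε₂ = -K` of the
basis vectors. -/
def comp (k : Fin 2) (v : Cl) : ℝ := ![v.imJ, -v.imK] k

theorem sum_comp_smul_gen (v : Cl) : ∑ k, comp k v • gen k = proj v := by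
  simp [proj_eq, comp]

theorem comp_sum_smul_gen (c : Fin 2 → ℝ) (k : Fin 2) : comp k (∑ j, c j • gen j) = c k := by
  fin_cases k <;> simp [comp, gen_zero, gen_one]

/-- The Dirac equation for the covariant derivatives `p 0`, `p 1` of `q` in the directions of an
orthonormal frame, multiplied by `i q̄` from the right. The four real components of the product say
that the real parts of `pair (p j) q` vanish (given that the `I`-components do), and determine the
trace and the antisymmetric part of the remaining components. -/
theorem dirac_pair {q : Cl} {p : Fin 2 → Cl} (hp : ∀ j, (pair (p j) q).imI = 0)
    {H τ : ℝ} (h : gen 0 * p 0 + gen 1 * p 1 = -(H • (q * I)) + τ • (-(I * q) * I)) :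
    (∀ j, (pair (p j) q).re = 0) ∧
    -(pair (p 0) q).imJ + (pair (p 1) q).imK = H * Quaternion.normSq q ∧
    (pair (p 0) q).imK + (pair (p 1) q).imJ = τ * Quaternion.normSq q := by
  have h1 : gen 0 * pair (p 0) q + gen 1 * pair (p 1) q
      = (H * Quaternion.normSq q) • 1 + (τ * Quaternion.normSq q) • I := by
    have h2 : q * star q = ((Quaternion.normSq q : ℝ) : Cl) := Quaternion.self_mul_star q
    have h3 : gen 0 * pair (p 0) q + gen 1 * pair (p 1) q
      = (gen 0 * p 0 + gen 1 * p 1) * I * star q := by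
      simp only [pair, add_mul, mul_assoc]
    rw [h3, h]
    simp only [add_mul, neg_mul, smul_mul_assoc, mul_assoc, I_mul_I, mul_neg, mul_one,
      smul_neg, neg_neg, h2]
    rw [mul_smul, mul_smul, ← Quaternion.coe_mul_eq_smul (Quaternion.normSq q),
      ← Quaternion.coe_mul_eq_smul (Quaternion.normSq q), mul_one, ← Quaternion.coe_commutes]
  have e0 := congrArg (fun v : Cl ↦ v.re) h1
  have e1 := congrArg (fun v : Cl ↦ v.imI) h1
  have e2 := congrArg (fun v : Cl ↦ v.imJ) h1
  have e3 := congrArg (fun v : Cl ↦ v.imK) h1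
  simp [gen_zero, gen_one, hp] at e0 e1 e2 e3
  refine ⟨fun j ↦ ?_, ?_, ?_⟩
  · fin_cases j
    · simpa using e2
    · simpa using e3
  · linarith
  · linarith

theorem proj_eq_self {v : Cl} (h0 : v.re = 0) (h1 : v.imI = 0) : proj v = v := by
  rw [proj_eq, gen_zero, gen_one]
  ext <;> simp [h0, h1]

theorem red_eq_self {q p : Cl} (h : (pair p q).re = 0) : red q p = p := by
  simp [red, h]

theorem contDiff_star : ContDiff ℝ ∞ (star : Cl → Cl) :=
  (LinearMap.toContinuousLinearMap
    { toFun := star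
      map_add' := star_add
      map_smul' := Quaternion.star_smul } : Cl →L[ℝ] Cl).contDiff

theorem contDiff_re : ContDiff ℝ ∞ (fun q : Cl ↦ q.re) :=
  (LinearMap.toContinuousLinearMap
    { toFun := fun q : Cl ↦ q.re
      map_add' := fun _ _ ↦ rfl
      map_smul' := fun _ _ ↦ rfl } : Cl →L[ℝ] ℝ).contDiff

/-- `comp k` as a continuous linear functional. -/
def compL (k : Fin 2) : Cl →L[ℝ] ℝ :=
  LinearMap.toContinuousLinearMap
    { toFun := comp k
      map_add' := fun _ _ ↦ by fin_cases k <;> simp [comp, add_comm]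
      map_smul' := fun _ _ ↦ by fin_cases k <;> simp [comp] }

theorem contDiff_comp (k : Fin 2) : ContDiff ℝ ∞ (comp k) :=
  (compL k).contDiff

theorem contDiff_pair : ContDiff ℝ ∞ (fun z : Cl × Cl ↦ pair z.1 z.2) :=
  (contDiff_fst.mul contDiff_const).mul (contDiff_star.comp contDiff_snd)

theorem contDiff_red : ContDiff ℝ ∞ (fun z : Cl × Cl ↦ red z.1 z.2) :=
  contDiff_snd.add ((contDiff_re.comp (contDiff_pair.comp (contDiff_snd.prodMk contDiff_fst))).smul
    (contDiff_const.mul contDiff_fst))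

theorem contDiffAt_shape (τ : ℝ) (w : Cl) {z : Cl × Cl} (hz : Quaternion.normSq z.1 ≠ 0) :
    ContDiffAt ℝ ∞ (fun z : Cl × Cl ↦ shape τ z.1 z.2 w) z := by
  have h1 : ContDiff ℝ ∞ (fun z : Cl × Cl ↦ Quaternion.normSq z.1) := by
    simp only [Quaternion.normSq_def]
    exact contDiff_re.comp (contDiff_fst.mul (contDiff_star.comp contDiff_fst))
  exact ((contDiffAt_const.div h1.contDiffAt hz).neg.smul
    (contDiff_pair.comp (contDiff_red.prodMk contDiff_fst)).contDiffAt).sub contDiffAt_const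

end Cl

/-! ### Derivatives along the surface -/

variable {M : Type*} [TopologicalSpace M] [ChartedSpace E2 M]

theorem mvfderiv_mul_apply {f g : M → Cl} {x : M} (hf : MDifferentiableAt (𝓡 2) 𝓘(ℝ, Cl) f x)
    (hg : MDifferentiableAt (𝓡 2) 𝓘(ℝ, Cl) g x) (X : T x) :
    mvfderiv (𝓡 2) (fun y ↦ f y * g y) x X =
      f x * mvfderiv (𝓡 2) g x X + mvfderiv (𝓡 2) f x X * g x := by
  have := (hf.hasMFDerivAt.mul' hg.hasMFDerivAt).mfderiv
  exact congrArg (fun L : E2 →L[ℝ] Cl ↦ L X) this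

/-- The chain rule for a composite `F ∘ f` that is locally constant. -/
theorem mvfderiv_apply_eq_zero {G : Type*} [NormedAddCommGroup G] [NormedSpace ℝ G] {f : M → Cl}
    {x : M} (hf : MDifferentiableAt (𝓡 2) 𝓘(ℝ, Cl) f x) {F : Cl → G} {F' : Cl →L[ℝ] G}
    (hF : HasFDerivAt F F' (f x)) {c : G} (hc : ∀ᶠ y in nhds x, F (f y) = c) (X : T x) :
    F' (mvfderiv (𝓡 2) f x X) = 0 := by
  have h1 := (hF.hasMFDerivAt.comp x hf.hasMFDerivAt).mfderiv
  have h2 : mfderiv (𝓡 2) 𝓘(ℝ, G) (F ∘ f) x = 0 := by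
    have hc' : F ∘ f =ᶠ[nhds x] fun _ ↦ c := hc
    rw [hc'.mfderiv_eq]
    exact mfderiv_const
  rw [h1] at h2
  exact congrArg (fun L : E2 →L[ℝ] G ↦ L X) h2

/-- Along a spinor field on which `form` is constant, the derivative is orthogonal to the field for
the polarized form. -/
theorem pair_mvfderiv_imI {f : M → Cl} {x : M} (hf : MDifferentiableAt (𝓡 2) 𝓘(ℝ, Cl) f x)
    {c : ℝ} (hc : ∀ᶠ y in nhds x, Cl.form (f y) = c) (X : T x) :
    (Cl.pair (mvfderiv (𝓡 2) f x X) (f x)).imI = 0 := by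
  obtain ⟨F, hF, hF'⟩ := Cl.exists_hasFDerivAt_form (f x)
  have h := mvfderiv_apply_eq_zero hf hF hc X
  rw [hF'] at h
  linarith

theorem contMDiffAt_mvfderiv_apply [IsManifold (𝓡 2) ∞ M] {f : M → Cl} {x : M}
    (hf : ContMDiffAt (𝓡 2) 𝓘(ℝ, Cl) ∞ f x)
    {X : ∀ y : M, T y} (hX : ContMDiffAt (𝓡 2) ((𝓡 2).prod 𝓘(ℝ, E2)) ∞
      (fun y ↦ (⟨y, X y⟩ : TangentBundle (𝓡 2) M)) x) :
    ContMDiffAt (𝓡 2) 𝓘(ℝ, Cl) ∞ (fun y ↦ mvfderiv (𝓡 2) f y (X y)) x := by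
  have h1 := ContMDiffAt.mfderiv_const hf (m := ∞) (by simp)
  have h2 := ContMDiffAt.clm_apply_of_inCoordinates (b₁ := id) (b₂ := f) h1 hX hf
  exact (contMDiff_snd_tangentBundle_modelSpace Cl 𝓘(ℝ, Cl)).contMDiffAt.comp x h2

/-- As the plane is finite-dimensional, a family of its endomorphisms is smooth if it is so on each
vector. -/
theorem contMDiffAt_clm_of_apply {f : M → E2 →L[ℝ] E2} {x : M}
    (hf : ∀ w, ContMDiffAt (𝓡 2) 𝓘(ℝ, E2) ∞ (fun y ↦ f y w) x) :
    ContMDiffAt (𝓡 2) 𝓘(ℝ, E2 →L[ℝ] E2) ∞ f x := by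
  let b := EuclideanSpace.basisFun (Fin 2) ℝ
  have h : f = fun y ↦ ∑ i,
      ContinuousLinearMap.smulRightL ℝ E2 E2 (innerSL ℝ (b i)) (f y (b i)) := by
    funext y
    ext1 w
    conv_lhs => rw [← b.sum_repr' w]
    simp
  rw [h]
  refine contMDiffAt_finsetSum fun i _ ↦ ?_
  exact (ContinuousLinearMap.contMDiff _).contMDiffAt.comp x (hf (b i))

/-- The derivative of a map into `Spin(2)`, whose Lie algebra is spanned by `I`. -/
theorem exists_mvfderiv_eq_smul_I_mul {g : M → Cl} {x : M}
    (hg : MDifferentiableAt (𝓡 2) 𝓘(ℝ, Cl) g x) (hs : ∀ᶠ y in nhds x, g y ∈ Cl.spin) (X : T x) :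
    ∃ c : ℝ, mvfderiv (𝓡 2) g x X = c • (Cl.I * g x) := by
  obtain ⟨hJ, hK, hn⟩ := hs.self_of_nhds
  -- On `Spin(2)` the quadratic form `form` agrees with `normSq`, hence is constant.
  have h1 := pair_mvfderiv_imI hg (c := 1) (by
    filter_upwards [hs] with y hy
    have := hy.2.2
    rw [Quaternion.normSq_def', hy.1, hy.2.1] at this
    rw [Cl.form_eq, hy.1, hy.2.1]
    linarith) X
  have h2 : ∀ k, Cl.comp k (mvfderiv (𝓡 2) g x X) = 0 := fun k ↦
    mvfderiv_apply_eq_zero hg (F := Cl.compL k) (Cl.compL k).hasFDerivAt (c := 0) (by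
      filter_upwards [hs] with y hy
      change Cl.comp k (g y) = 0
      fin_cases k <;> simp [Cl.comp, hy.1, hy.2.1]) X
  have h3 := h2 0
  have h4 := h2 1
  rw [Quaternion.normSq_def', hJ, hK] at hn
  generalize mvfderiv (𝓡 2) g x X = p at *
  simp only [Cl.comp, Matrix.cons_val_zero, Matrix.cons_val_one, neg_eq_zero] at h3 h4
  simp [Cl.pair, hJ, hK, h3, h4] at h1
  refine ⟨p.imI * (g x).re - p.re * (g x).imI, ?_⟩
  ext <;> simp [hJ, hK, h3, h4]
  · linear_combination (-p.re) * hn + (g x).re * h1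
  · linear_combination (-p.imI) * hn + (g x).imI * h1

section Riemannian

/-! ### Linear algebra of the tangent plane -/

variable [RiemannianBundle (fun x : M ↦ T x)]

section vec
variable {x : M} {e : Fin 2 → T x}

theorem vec_sum {α : Type*} (s : Finset α) (c : α → ℝ) (X : α → T x) :
    vec e (∑ j ∈ s, c j • X j) = ∑ j ∈ s, c j • vec e (X j) := by
  simp only [vec, inner_sum, real_inner_smul_right, Finset.smul_sum, smul_smul, Finset.sum_smul]
  rw [Finset.sum_comm]

theorem vec_frame (he : Orthonormal ℝ e) (j : Fin 2) : vec e (e j) = Cl.gen j := by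
  simp [vec, orthonormal_iff_ite.1 he]

theorem exists_orthonormalBasis (he : Orthonormal ℝ e) :
    ∃ b : OrthonormalBasis (Fin 2) ℝ (T x), ⇑b = e := by
  have hfin : Module.finrank ℝ (T x) = 2 := by
    change Module.finrank ℝ E2 = 2
    simp
  have : FiniteDimensional ℝ (T x) := Module.finite_of_finrank_eq_succ hfin
  have hs := he.linearIndependent.span_eq_top_of_card_eq_finrank (by simp [hfin])
  exact ⟨OrthonormalBasis.mk he hs.ge, OrthonormalBasis.coe_mk he hs.ge⟩

theorem sum_inner_smul (he : Orthonormal ℝ e) (X : T x) : ∑ j, inner ℝ (e j) X • e j = X := by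
  obtain ⟨b, rfl⟩ := exists_orthonormalBasis he
  exact b.sum_repr' X

theorem vec_injective (he : Orthonormal ℝ e) {X Y : T x} (h : vec e X = vec e Y) : X = Y := by
  rw [← sum_inner_smul he X, ← sum_inner_smul he Y]
  refine Finset.sum_congr rfl fun j _ ↦ ?_
  rw [← Cl.comp_sum_smul_gen (fun j ↦ inner ℝ (e j) X) j,
    ← Cl.comp_sum_smul_gen (fun j ↦ inner ℝ (e j) Y) j]
  exact congrArg (fun v ↦ Cl.comp j v • e j) h

end vec

theorem trace_eq {x : M} {e : Fin 2 → T x} (he : Orthonormal ℝ e) (A : T x →L[ℝ] T x) :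
    LinearMap.trace ℝ (T x) (A : T x →ₗ[ℝ] T x) =
      inner ℝ (e 0) (A (e 0)) + inner ℝ (e 1) (A (e 1)) := by
  obtain ⟨b, rfl⟩ := exists_orthonormalBasis he
  rw [LinearMap.trace_eq_sum_inner _ b, Fin.sum_univ_two]
  rfl

/-- The endomorphism `X ↦ ⟨Y, X⟩ Z` of the tangent plane. -/
def rankOne {x : M} (Y Z : T x) : T x →L[ℝ] T x := (innerSL ℝ Y).smulRight Z

theorem rankOne_apply {x : M} (Y Z X : T x) : rankOne Y Z X = (inner ℝ Y X : ℝ) • Z := rfl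

variable [IsManifold (𝓡 2) ∞ M]

/-- In the trivialization of the tangent bundle around `x`, the endomorphism `rankOne Y Z` maps a
fixed vector `w` to a smooth multiple of the coordinates of `Z`. -/
theorem contMDiffAt_rankOne [IsContMDiffRiemannianBundle (𝓡 2) ∞ E2 (fun x : M ↦ T x)]
    {Y Z : ∀ y : M, T y} {x : M}
    (hY : ContMDiffAt (𝓡 2) ((𝓡 2).prod 𝓘(ℝ, E2)) ∞
      (fun y ↦ (⟨y, Y y⟩ : TangentBundle (𝓡 2) M)) x)
    (hZ : ContMDiffAt (𝓡 2) ((𝓡 2).prod 𝓘(ℝ, E2)) ∞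
      (fun y ↦ (⟨y, Z y⟩ : TangentBundle (𝓡 2) M)) x) :
    ContMDiffAt (𝓡 2) ((𝓡 2).prod 𝓘(ℝ, E2 →L[ℝ] E2)) ∞
      (fun y ↦ (⟨y, rankOne (Y y) (Z y)⟩ :
        TotalSpace (E2 →L[ℝ] E2) fun y : M ↦ T y →L[ℝ] T y)) x := by
  rw [contMDiffAt_hom_bundle]
  refine ⟨contMDiffAt_id, contMDiffAt_clm_of_apply fun w ↦ ?_⟩
  let t := trivializationAt E2 (TangentSpace (𝓡 2) : M → Type _) x
  have hx : x ∈ t.baseSet := mem_baseSet_trivializationAt E2 _ x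
  have hw : ContMDiffAt (𝓡 2) ((𝓡 2).prod 𝓘(ℝ, E2)) ∞
      (fun y ↦ (⟨y, t.symm y w⟩ : TangentBundle (𝓡 2) M)) x := by
    rw [t.contMDiffAt_section_iff hx]
    refine (contMDiffAt_const (c := w)).congr_of_eventuallyEq ?_
    filter_upwards [t.open_baseSet.mem_nhds hx] with y hy
    rw [t.apply_mk_symm hy]
  have h1 := (t.contMDiffAt_section_iff hx).1 hZ
  refine ((hY.inner_bundle hw).smul h1).congr_of_eventuallyEq ?_
  filter_upwards [t.open_baseSet.mem_nhds hx] with y hy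
  change t.continuousLinearMapAt ℝ y (rankOne (Y y) (Z y) (t.symmL ℝ y w)) = _
  rw [rankOne_apply, map_smul, t.continuousLinearMapAt_apply_of_mem ℝ hy, t.symmL_apply hy]
  rfl

/-! ### Spinors in a gauge -/

variable {o : SurfaceOrientation M} {ι : Type*} {Q : SpinStructure o ι}

namespace SpinStructure

theorem coord_ofCoord {x : M} (q : Cl) :
    Q.coord (Q.indexAt x) (Q.ofCoord (Q.indexAt x) x q) = q := by
  rw [coord, ofCoord, (Q.core.localTriv (Q.indexAt x)).mk_symm (Q.mem_baseSet_at x),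
    (Q.core.localTriv (Q.indexAt x)).apply_symm_apply']
  exact Q.mem_baseSet_at x

theorem coord_injective {x : M} {ψ φ : Q.SpinorBundle x}
    (h : Q.coord (Q.indexAt x) ψ = Q.coord (Q.indexAt x) φ) : ψ = φ :=
  ((Q.core.localTriv (Q.indexAt x)).linearEquivAt ℝ x (Q.mem_baseSet_at x)).injective h

theorem coord_add {x : M} (a : ι) (ψ φ : Q.SpinorBundle x) :
    Q.coord a (ψ + φ) = Q.coord a ψ + Q.coord a φ := by
  simp only [coord, VectorBundleCore.localTriv_apply]
  exact (Q.core.coordChange (Q.indexAt x) a x).map_add ψ φ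

theorem coord_smul {x : M} (a : ι) (c : ℝ) (ψ : Q.SpinorBundle x) :
    Q.coord a (c • ψ) = c • Q.coord a ψ := by
  simp only [coord, VectorBundleCore.localTriv_apply]
  exact (Q.core.coordChange (Q.indexAt x) a x).map_smul c ψ

theorem coord_neg {x : M} (a : ι) (ψ : Q.SpinorBundle x) : Q.coord a (-ψ) = -Q.coord a ψ := by
  simpa using coord_smul a (-1) ψ

theorem coord_sub {x : M} (a : ι) (ψ φ : Q.SpinorBundle x) :
    Q.coord a (ψ - φ) = Q.coord a ψ - Q.coord a φ := by
  rw [sub_eq_add_neg, coord_add, coord_neg, sub_eq_add_neg]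

theorem coord_eq_trans_mul {a b : ι} {x : M} (ha : x ∈ Q.baseSet a) (hb : x ∈ Q.baseSet b)
    (ψ : Q.SpinorBundle x) : Q.coord a ψ = Q.trans a b x * Q.coord b ψ := by
  simp only [coord, VectorBundleCore.localTriv_apply]
  exact (Q.core.coordChange_comp (Q.indexAt x) b a x ⟨⟨Q.mem_baseSet_at x, hb⟩, ha⟩ ψ).symm

theorem orthonormal_frameAt (x : M) : Orthonormal ℝ (Q.frameAt x) :=
  Q.orthonormal_frame _ x (Q.mem_baseSet_at x)

theorem coord_clifford {x : M} (X : T x) (ψ : Q.SpinorBundle x) :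
    Q.coord (Q.indexAt x) (Q.clifford X ψ) =
      vec (Q.frameAt x) X * Q.coord (Q.indexAt x) ψ :=
  coord_ofCoord _

theorem coord_iMul {x : M} (ψ : Q.SpinorBundle x) :
    Q.coord (Q.indexAt x) (Q.iMul ψ) = Q.coord (Q.indexAt x) ψ * Cl.I :=
  coord_ofCoord _

theorem coord_omega {x : M} (ψ : Q.SpinorBundle x) :
    Q.coord (Q.indexAt x) (Q.omega ψ) = -(Cl.I * Q.coord (Q.indexAt x) ψ) := by
  rw [omega, coord_clifford, coord_clifford, vec_frame (orthonormal_frameAt x),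
    vec_frame (orthonormal_frameAt x), ← mul_assoc, Cl.gen_mul_gen, neg_mul]

theorem coord_nabla (ψ : ∀ x, Q.SpinorBundle x) {x : M} (X : T x) :
    Q.coord (Q.indexAt x) (Q.nabla ψ X) =
      mvfderiv (𝓡 2) (fun y ↦ Q.coord (Q.indexAt x) (ψ y)) x X
        + (-(1 / 2 * Q.connectionForm (Q.indexAt x) X)) •
          (Cl.I * Q.coord (Q.indexAt x) (ψ x)) := by
  rw [nabla, coord_ofCoord, Cl.gen_mul_gen, neg_mul, smul_neg, neg_smul]

theorem coord_dirac (ψ : ∀ x, Q.SpinorBundle x) (x : M) :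
    Q.coord (Q.indexAt x) (Q.dirac ψ x) =
      Cl.gen 0 * Q.coord (Q.indexAt x) (Q.nabla ψ (Q.frameAt x 0)) +
        Cl.gen 1 * Q.coord (Q.indexAt x) (Q.nabla ψ (Q.frameAt x 1)) := by
  rw [dirac, Fin.sum_univ_two, coord_add, coord_clifford, coord_clifford,
    vec_frame (orthonormal_frameAt x), vec_frame (orthonormal_frameAt x)]

theorem form_coord {a b : ι} {x : M} (ha : x ∈ Q.baseSet a) (hb : x ∈ Q.baseSet b)
    (ψ : Q.SpinorBundle x) : Cl.form (Q.coord a ψ) = Cl.form (Q.coord b ψ) := by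
  rw [coord_eq_trans_mul ha hb, Cl.form_mul (Q.trans_mem _ _ x ⟨ha, hb⟩)]

theorem normSq_plus_sub_normSq_minus {x : M} (ψ : Q.SpinorBundle x) :
    Q.normSq (Q.plus ψ) - Q.normSq (Q.minus ψ) = Cl.form (Q.coord (Q.indexAt x) ψ) := by
  simp only [normSq, plus, minus, coord_smul, coord_add, coord_sub, coord_iMul, coord_omega]
  generalize Q.coord (Q.indexAt x) ψ = q
  rw [Quaternion.normSq_def', Quaternion.normSq_def', Cl.form_eq]
  simp
  ring

theorem contMDiffOn_coord (ψ : Q.SpinorField) (a : ι) :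
    ContMDiffOn (𝓡 2) 𝓘(ℝ, Cl) ∞ (fun y ↦ Q.coord a (ψ y)) (Q.baseSet a) := by
  have : MemTrivializationAtlas (Q.core.localTriv a) := ⟨⟨a, rfl⟩⟩
  exact ((Q.core.localTriv a).contMDiffOn_section_baseSet_iff (n := ∞) (IB := 𝓡 2) (s := ψ)).1
    ψ.contMDiff.contMDiffOn

theorem mdifferentiableAt_coord (ψ : Q.SpinorField) {a : ι} {x : M} (hx : x ∈ Q.baseSet a) :
    MDifferentiableAt (𝓡 2) 𝓘(ℝ, Cl) (fun y ↦ Q.coord a (ψ y)) x :=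
  ((contMDiffOn_coord ψ a).contMDiffAt ((Q.isOpen_baseSet a).mem_nhds hx)).mdifferentiableAt
    (by simp)

/-! ### The endomorphism field determined by a spinor field -/

variable (Q) in
/-- The coefficient of `e_k` in `S e_j`, for the orthonormal frame `e = frame a` and the
endomorphism `S` determined by the spinor field `ψ`. -/
def shapeCoeff (τ : ℝ) (ψ : ∀ x, Q.SpinorBundle x) (a : ι) (k j : Fin 2) (x : M) : ℝ :=
  Cl.comp k (Cl.shape τ (Q.coord a (ψ x))
    (mvfderiv (𝓡 2) (fun y ↦ Q.coord a (ψ y)) x (Q.frame a j x)) (Cl.gen j))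

variable (Q) in
/-- The endomorphism of the tangent plane determined by `ψ`, computed in the gauge `a`: its matrix
in the frame of that gauge is `shapeCoeff`. -/
def shapeEndo (τ : ℝ) (ψ : ∀ x, Q.SpinorBundle x) (a : ι) (x : M) : T x →L[ℝ] T x :=
  ∑ j, rankOne (Q.frame a j x) (∑ k, Q.shapeCoeff τ ψ a k j x • Q.frame a k x)

/-- The Clifford element of `S X` is `shape` up to the components along `1` and `I`. The latter vanish
if `ψ` solves the Dirac equation, but not in general. -/
theorem vec_shapeEndo (τ : ℝ) (ψ : ∀ x, Q.SpinorBundle x) {a : ι} {x : M} (ha : x ∈ Q.baseSet a)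
    (X : T x) :
    vec (fun j ↦ Q.frame a j x) (Q.shapeEndo τ ψ a x X) =
      Cl.proj (Cl.shape τ (Q.coord a (ψ x)) (mvfderiv (𝓡 2) (fun y ↦ Q.coord a (ψ y)) x X)
        (vec (fun j ↦ Q.frame a j x) X)) := by
  have he := Q.orthonormal_frame a x ha
  have h1 : ∀ j, vec (fun j ↦ Q.frame a j x) (Q.frame a j x) = Cl.gen j := vec_frame he
  have hX := sum_inner_smul he X
  have hp : mvfderiv (𝓡 2) (fun y ↦ Q.coord a (ψ y)) x X = ∑ j, inner ℝ (Q.frame a j x) X •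
      mvfderiv (𝓡 2) (fun y ↦ Q.coord a (ψ y)) x (Q.frame a j x) := by
    conv_lhs => rw [← hX]
    simp only [map_sum, map_smul]
  have hl : vec (fun j ↦ Q.frame a j x) (Q.shapeEndo τ ψ a x X) =
      ∑ j, inner ℝ (Q.frame a j x) X • Cl.proj (Cl.shape τ (Q.coord a (ψ x))
    (mvfderiv (𝓡 2) (fun y ↦ Q.coord a (ψ y)) x (Q.frame a j x)) (Cl.gen j)) := by
    simp only [shapeEndo, sum_apply, rankOne_apply, vec_sum, h1,
      ← Cl.sum_comp_smul_gen, shapeCoeff]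
  rw [hl, hp, vec, Cl.shape_sum]
  simp only [Cl.proj, Finset.mul_sum, Finset.sum_mul, Finset.smul_sum, smul_add,
    Finset.sum_add_distrib, mul_smul_comm, smul_mul_assoc]
  congr 1 <;> exact Finset.sum_congr rfl fun j _ ↦ smul_comm _ _ _

theorem contMDiffAt_shapeCoeff (τ : ℝ) (ψ : Q.SpinorField) {a : ι} {x : M}
    (ha : x ∈ Q.baseSet a) (hψ : Quaternion.normSq (Q.coord a (ψ x)) ≠ 0) (k j : Fin 2) :
    ContMDiffAt (𝓡 2) 𝓘(ℝ, ℝ) ∞ (Q.shapeCoeff τ ψ a k j) x := by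
  have hU := (Q.isOpen_baseSet a).mem_nhds ha
  have hq := (contMDiffOn_coord ψ a).contMDiffAt hU
  have hp := hq.prodMk_space
    (contMDiffAt_mvfderiv_apply hq ((Q.contMDiffOn_frame a j).contMDiffAt hU))
  have hF : ContDiffAt ℝ ∞ (fun z : Cl × Cl ↦ Cl.comp k (Cl.shape τ z.1 z.2 (Cl.gen j)))
      (Q.coord a (ψ x), mvfderiv (𝓡 2) (fun y ↦ Q.coord a (ψ y)) x (Q.frame a j x)) :=
    (Cl.contDiff_comp k).contDiffAt.comp _ (Cl.contDiffAt_shape τ (Cl.gen j) hψ)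
  exact hF.comp_contMDiffAt (f := fun y ↦ (Q.coord a (ψ y),
    mvfderiv (𝓡 2) (fun y ↦ Q.coord a (ψ y)) y (Q.frame a j y))) hp

theorem contMDiffAt_shapeEndo [IsContMDiffRiemannianBundle (𝓡 2) ∞ E2 (fun x : M ↦ T x)]
    (τ : ℝ) (ψ : Q.SpinorField) {a : ι} {x : M} (ha : x ∈ Q.baseSet a)
    (hψ : Quaternion.normSq (Q.coord a (ψ x)) ≠ 0) :
    ContMDiffAt (𝓡 2) ((𝓡 2).prod 𝓘(ℝ, E2 →L[ℝ] E2)) ∞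
      (fun y ↦ (⟨y, Q.shapeEndo τ ψ a y⟩ :
        TotalSpace (E2 →L[ℝ] E2) fun y : M ↦ T y →L[ℝ] T y)) x := by
  have he := fun j ↦ (Q.contMDiffOn_frame a j).contMDiffAt ((Q.isOpen_baseSet a).mem_nhds ha)
  have hV : ∀ j, ContMDiffAt (𝓡 2) ((𝓡 2).prod 𝓘(ℝ, E2)) ∞
      (fun y ↦ (⟨y, ∑ k, Q.shapeCoeff τ ψ a k j y • Q.frame a k y⟩ : TangentBundle (𝓡 2) M)) x :=
    fun j ↦ ContMDiffAt.sum_section fun k _ ↦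
      (contMDiffAt_shapeCoeff τ ψ ha hψ k j).smul_section (he k)
  have hR := fun j ↦ contMDiffAt_rankOne (he j) (hV j)
  simp only [shapeEndo, Fin.sum_univ_two]
  simp only [Fin.sum_univ_two] at hR
  exact (hR 0).add_section (hR 1)

/-- The endomorphism determined by a normalized `ψ` does not depend on the gauge, whether or not `ψ`
solves the Dirac equation. -/
theorem shapeEndo_eq (τ : ℝ) (ψ : Q.SpinorField)
    (hψ : ∀ x, Cl.form (Q.coord (Q.indexAt x) (ψ x)) = 1) {a b : ι} {x : M}
    (ha : x ∈ Q.baseSet a) (hb : x ∈ Q.baseSet b) :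
    Q.shapeEndo τ ψ a x = Q.shapeEndo τ ψ b x := by
  have hg := Q.trans_mem a b x ⟨ha, hb⟩
  have hU : Q.baseSet a ∩ Q.baseSet b ∈ nhds x :=
    ((Q.isOpen_baseSet a).inter (Q.isOpen_baseSet b)).mem_nhds ⟨ha, hb⟩
  have hq : Cl.form (Q.coord b (ψ x)) = 1 := by rw [form_coord hb (Q.mem_baseSet_at x), hψ]
  have hgd : MDifferentiableAt (𝓡 2) 𝓘(ℝ, Cl) (Q.trans a b) x :=
    ((Q.contMDiffOn_trans a b).contMDiffAt hU).mdifferentiableAt (by simp)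
  ext1 X
  refine vec_injective (Q.orthonormal_frame a x ha) ?_
  have hv := Q.vec_mul_trans a b x ⟨ha, hb⟩
  have hcancel : ∀ u v : Cl, u * Q.trans a b x = v * Q.trans a b x → u = v := fun u v h ↦ by
    have h0 : Q.trans a b x ≠ 0 := by
      intro h0
      have := hg.2.2
      simp [h0] at this
    exact mul_right_cancel₀ h0 h
  -- Both sides are compared after right multiplication by the transition function, which turns the
  -- frame `a` on one side into the frame `b`.
  refine hcancel _ _ ?_
  rw [hv (Q.shapeEndo τ ψ b x X), vec_shapeEndo τ _ ha, vec_shapeEndo τ _ hb]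
  refine Cl.proj_mul hg ?_
  obtain ⟨c, hc⟩ : ∃ c : ℝ, mvfderiv (𝓡 2) (Q.trans a b) x X = c • (Cl.I * Q.trans a b x) :=
    exists_mvfderiv_eq_smul_I_mul hgd
      (by filter_upwards [hU] with y hy using Q.trans_mem a b y hy) X
  have hd : mvfderiv (𝓡 2) (fun y ↦ Q.coord a (ψ y)) x X =
      Q.trans a b x * mvfderiv (𝓡 2) (fun y ↦ Q.coord b (ψ y)) x X
        + c • (Cl.I * (Q.trans a b x * Q.coord b (ψ x))) := by
    have h1 : (fun y ↦ Q.coord a (ψ y)) =ᶠ[nhds x] fun y ↦ Q.trans a b y * Q.coord b (ψ y) := by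
      filter_upwards [hU] with y hy using coord_eq_trans_mul hy.1 hy.2 _
    have h2 : mvfderiv (𝓡 2) (fun y ↦ Q.coord a (ψ y)) x X =
        mvfderiv (𝓡 2) (fun y ↦ Q.trans a b y * Q.coord b (ψ y)) x X := by
      have h3 := congrArg (fun L : E2 →L[ℝ] Cl ↦ L X)
        (h1.mfderiv_eq (I := 𝓡 2) (I' := 𝓘(ℝ, Cl)))
      exact h3
    rw [h2, mvfderiv_mul_apply hgd (mdifferentiableAt_coord ψ hb), hc, smul_mul_assoc, mul_assoc]
  rw [coord_eq_trans_mul ha hb]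
  exact Cl.shape_mul c hg hq hd (hv X)

/-! ### The two equations at a point -/

theorem connectionForm_eq_sum {a : ι} {x : M} (hx : x ∈ Q.baseSet a) (X : T x) :
    Q.connectionForm a X =
      ∑ j, inner ℝ (Q.frame a j x) X * Q.connectionForm a (Q.frame a j x) := by
  have h := orthonormal_iff_ite.1 (Q.orthonormal_frame a x hx)
  simp [connectionForm, h]

/-- Linearity of `∇_X ψ` in `X`, in the frame at the point. -/
theorem coord_nabla_eq_sum (ψ : ∀ x, Q.SpinorBundle x) {x : M} (X : T x) :
    Q.coord (Q.indexAt x) (Q.nabla ψ X) =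
      ∑ j, inner ℝ (Q.frameAt x j) X • Q.coord (Q.indexAt x) (Q.nabla ψ (Q.frameAt x j)) := by
  have hL (L : T x →L[ℝ] Cl) :
      L X = ∑ j, inner ℝ (Q.frameAt x j) X • L (Q.frameAt x j) := by
    conv_lhs => rw [← sum_inner_smul (orthonormal_frameAt (Q := Q) x) X]
    simp only [map_sum, map_smul]
  simp only [coord_nabla, smul_add, Finset.sum_add_distrib, smul_smul, ← Finset.sum_smul]
  rw [hL, connectionForm_eq_sum (Q.mem_baseSet_at x), Finset.mul_sum, ← Finset.sum_neg_distrib]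
  congr 2
  exact Finset.sum_congr rfl fun j _ ↦ by rw [frameAt]; ring

theorem inner_frame_shapeEndo (τ : ℝ) (ψ : ∀ x, Q.SpinorBundle x) {a : ι} {x : M}
    (ha : x ∈ Q.baseSet a) (k : Fin 2) (X : T x) :
    inner ℝ (Q.frame a k x) (Q.shapeEndo τ ψ a x X) =
      ∑ j, Q.shapeCoeff τ ψ a k j x * inner ℝ (Q.frame a j x) X := by
  have h := orthonormal_iff_ite.1 (Q.orthonormal_frame a x ha)
  simp only [shapeEndo, sum_apply, rankOne_apply, inner_sum, real_inner_smul_right, h]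
  simp [mul_comm]

/-- The equation for `∇_X ψ` determines `S X`, because a nonzero spinor is annihilated by no nonzero
vector. -/
theorem eq_of_killing {x : M} {ψ φ : Q.SpinorBundle x} {c : ℝ}
    (hψ : Cl.form (Q.coord (Q.indexAt x) ψ) = 1) {X Y Z : T x}
    (hY : φ = (1 / 2 : ℝ) • Q.iMul (Q.clifford Y ψ) - c • Q.iMul (Q.clifford X (Q.omega ψ)))
    (hZ : φ = (1 / 2 : ℝ) • Q.iMul (Q.clifford Z ψ) - c • Q.iMul (Q.clifford X (Q.omega ψ))) :
    Y = Z := by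
  rw [hY, sub_left_inj] at hZ
  have h := congrArg (Q.coord (Q.indexAt x)) hZ
  simp only [coord_smul, coord_iMul, coord_clifford] at h
  have hq : Q.coord (Q.indexAt x) ψ ≠ 0 := fun h0 ↦ Cl.normSq_ne_zero hψ (by simp [h0])
  have hI : Cl.I ≠ 0 := fun h0 ↦
    one_ne_zero (α := ℝ) (congrArg (fun v : Cl ↦ v.imI) h0)
  exact vec_injective (orthonormal_frameAt x)
    (mul_right_cancel₀ hq (mul_right_cancel₀ hI (smul_right_injective Cl (by norm_num) h)))

/-- Contracting the equation for `∇ ψ` with Clifford multiplication: since `A` is symmetric, the sum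
of the `e_j · A e_j` is `-tr A = -2 H`, and the sum of the `e_j · e_j` is `-2`. -/
theorem dirac_of_killing {ψ : ∀ x, Q.SpinorBundle x} {x : M} {τ H : ℝ} {A : T x →L[ℝ] T x}
    (hA : ∀ X Y : T x, inner ℝ (A X) Y = inner ℝ X (A Y))
    (hH : H = (1 / 2) * LinearMap.trace ℝ (T x) (A : T x →ₗ[ℝ] T x))
    (h : ∀ X : T x, Q.nabla ψ X =
      (1 / 2 : ℝ) • Q.iMul (Q.clifford (A X) (ψ x))
        - (τ / 2) • Q.iMul (Q.clifford X (Q.omega (ψ x)))) :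
    Q.dirac ψ x = -(H • Q.iMul (ψ x)) + τ • Q.iMul (Q.omega (ψ x)) := by
  have he := orthonormal_frameAt (Q := Q) x
  apply coord_injective
  rw [trace_eq he] at hH
  have hs : inner ℝ (Q.frameAt x 0) (A (Q.frameAt x 1))
      = inner ℝ (Q.frameAt x 1) (A (Q.frameAt x 0)) := by rw [← hA, real_inner_comm]
  simp only [coord_dirac, h, coord_sub, coord_smul, coord_iMul, coord_clifford, coord_omega,
    coord_add, coord_neg, vec_frame he, hH]
  simp only [vec, Fin.sum_univ_two, hs]
  generalize Q.coord (Q.indexAt x) (ψ x) = q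
  ext <;> simp [Cl.gen_zero, Cl.gen_one] <;> ring

/-- The correction in `red` removes the contribution of the connection form. -/
theorem red_mvfderiv {ψ : ∀ x, Q.SpinorBundle x} {x : M}
    (hψ : Cl.form (Q.coord (Q.indexAt x) (ψ x)) = 1) (X : T x) :
    Cl.red (Q.coord (Q.indexAt x) (ψ x)) (mvfderiv (𝓡 2) (fun y ↦ Q.coord (Q.indexAt x) (ψ y)) x X)
      = Cl.red (Q.coord (Q.indexAt x) (ψ x)) (Q.coord (Q.indexAt x) (Q.nabla ψ X)) := by
  rw [coord_nabla, Cl.red_add, Cl.red_smul, Cl.red_I_mul hψ, smul_zero, add_zero]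

theorem pair_nabla_imI (ψ : Q.SpinorField)
    (hψ : ∀ x, Cl.form (Q.coord (Q.indexAt x) (ψ x)) = 1) {x : M} (X : T x) :
    (Cl.pair (Q.coord (Q.indexAt x) (Q.nabla ψ X)) (Q.coord (Q.indexAt x) (ψ x))).imI = 0 := by
  have h := pair_mvfderiv_imI (mdifferentiableAt_coord ψ (Q.mem_baseSet_at x)) (c := 1) (by
    filter_upwards [(Q.isOpen_baseSet _).mem_nhds (Q.mem_baseSet_at x)] with y hy
    rw [form_coord hy (Q.mem_baseSet_at y), hψ]) X
  rw [coord_nabla, Cl.pair_add, Cl.pair_smul]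
  simp [h, Cl.pair_I_mul_imI]

section Dirac
variable {ψ : Q.SpinorField} {x : M} {τ H : ℝ}

/-- For a normalized solution of the Dirac equation, the components of `∇_X ψ` that would obstruct a
solution `S X` vanish, and the remaining ones have the trace and the antisymmetric part that make
`S` symmetric with trace `2 H`. -/
theorem dirac_pair_nabla (hψ : ∀ x, Cl.form (Q.coord (Q.indexAt x) (ψ x)) = 1)
    (hD : Q.dirac ψ x = -(H • Q.iMul (ψ x)) + τ • Q.iMul (Q.omega (ψ x))) :
    let P : T x → Cl := fun X ↦
      Cl.pair (Q.coord (Q.indexAt x) (Q.nabla ψ X)) (Q.coord (Q.indexAt x) (ψ x))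
    let N := Quaternion.normSq (Q.coord (Q.indexAt x) (ψ x))
    (∀ X, (P X).re = 0) ∧
      -(P (Q.frameAt x 0)).imJ + (P (Q.frameAt x 1)).imK = H * N ∧
      (P (Q.frameAt x 0)).imK + (P (Q.frameAt x 1)).imJ = τ * N := by
  have h := congrArg (Q.coord (Q.indexAt x)) hD
  simp only [coord_dirac, coord_add, coord_neg, coord_smul, coord_iMul, coord_omega] at h
  obtain ⟨h1, h2⟩ := Cl.dirac_pair
    (p := fun j ↦ Q.coord (Q.indexAt x) (Q.nabla ψ (Q.frameAt x j)))
    (fun j ↦ pair_nabla_imI ψ hψ _) h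
  refine ⟨fun X ↦ ?_, h2⟩
  change (Cl.pair (Q.coord (Q.indexAt x) (Q.nabla ψ X)) (Q.coord (Q.indexAt x) (ψ x))).re = 0
  rw [coord_nabla_eq_sum, Fin.sum_univ_two, Cl.pair_add, Cl.pair_smul, Cl.pair_smul]
  simp [h1]

/-- For a solution of the Dirac equation, `shape` is expressed by the covariant derivative. -/
theorem shape_eq (hψ : ∀ x, Cl.form (Q.coord (Q.indexAt x) (ψ x)) = 1)
    (hD : Q.dirac ψ x = -(H • Q.iMul (ψ x)) + τ • Q.iMul (Q.omega (ψ x))) (X : T x) (w : Cl) :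
    Cl.shape τ (Q.coord (Q.indexAt x) (ψ x))
        (mvfderiv (𝓡 2) (fun y ↦ Q.coord (Q.indexAt x) (ψ y)) x X) w =
      -(2 / Quaternion.normSq (Q.coord (Q.indexAt x) (ψ x))) •
        Cl.pair (Q.coord (Q.indexAt x) (Q.nabla ψ X)) (Q.coord (Q.indexAt x) (ψ x))
      - τ • (w * Cl.I) := by
  rw [Cl.shape, red_mvfderiv (hψ x), Cl.red_eq_self ((dirac_pair_nabla hψ hD).1 X)]

/-- The endomorphism field determined by a solution of the Dirac equation solves the equation for
`∇ ψ`: the Clifford element `shape` has no components along `1` and `I`, so the projection in the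
definition of the endomorphism loses nothing. -/
theorem nabla_eq_of_dirac (hψ : ∀ x, Cl.form (Q.coord (Q.indexAt x) (ψ x)) = 1)
    (hD : Q.dirac ψ x = -(H • Q.iMul (ψ x)) + τ • Q.iMul (Q.omega (ψ x))) (X : T x) :
    Q.nabla ψ X =
      (1 / 2 : ℝ) • Q.iMul (Q.clifford (Q.shapeEndo τ ψ (Q.indexAt x) x X) (ψ x))
        - (τ / 2) • Q.iMul (Q.clifford X (Q.omega (ψ x))) := by
  apply coord_injective
  have h1 := vec_shapeEndo τ ψ (Q.mem_baseSet_at x) X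
  have h2 := Cl.shape_mul_mul_I (τ := τ) (w := vec (Q.frameAt x) X)
    (p := mvfderiv (𝓡 2) (fun y ↦ Q.coord (Q.indexAt x) (ψ y)) x X) (Cl.normSq_ne_zero (hψ x))
  rw [red_mvfderiv (hψ x), Cl.red_eq_self ((dirac_pair_nabla hψ hD).1 X)] at h2
  rw [Cl.proj_eq_self] at h1
  · simp only [coord_sub, coord_smul, coord_iMul, coord_clifford, coord_omega]
    change vec (Q.frameAt x) _ = Cl.shape _ _ _ (vec (Q.frameAt x) X) at h1
    rw [h1, h2]
    simp only [smul_sub, smul_smul, mul_neg, neg_mul, smul_neg, mul_assoc]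
    norm_num
    ring_nf
    simp
  · rw [shape_eq hψ hD]
    simp [(dirac_pair_nabla hψ hD).1 X, vec, Fin.sum_univ_two, Cl.gen_zero, Cl.gen_one]
  · rw [shape_eq hψ hD]
    simp [pair_nabla_imI ψ hψ X, vec, Fin.sum_univ_two, Cl.gen_zero, Cl.gen_one]

theorem shapeCoeff_symm (hψ : ∀ x, Cl.form (Q.coord (Q.indexAt x) (ψ x)) = 1)
    (hD : Q.dirac ψ x = -(H • Q.iMul (ψ x)) + τ • Q.iMul (Q.omega (ψ x))) :
    Q.shapeCoeff τ ψ (Q.indexAt x) 0 1 x = Q.shapeCoeff τ ψ (Q.indexAt x) 1 0 x := by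
  have hN := Cl.normSq_ne_zero (hψ x)
  have h := (dirac_pair_nabla hψ hD).2.2
  rw [shapeCoeff, shapeCoeff, shape_eq hψ hD, shape_eq hψ hD]
  simp only [frameAt] at h
  simp [Cl.comp, Cl.gen_zero, Cl.gen_one]
  field_simp
  linear_combination (-2) * h

theorem shapeCoeff_trace (hψ : ∀ x, Cl.form (Q.coord (Q.indexAt x) (ψ x)) = 1)
    (hD : Q.dirac ψ x = -(H • Q.iMul (ψ x)) + τ • Q.iMul (Q.omega (ψ x))) :
    Q.shapeCoeff τ ψ (Q.indexAt x) 0 0 x + Q.shapeCoeff τ ψ (Q.indexAt x) 1 1 x = 2 * H := by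
  have hN := Cl.normSq_ne_zero (hψ x)
  have h := (dirac_pair_nabla hψ hD).2.1
  rw [shapeCoeff, shapeCoeff, shape_eq hψ hD, shape_eq hψ hD]
  simp only [frameAt] at h
  simp [Cl.comp, Cl.gen_zero, Cl.gen_one]
  field_simp
  linear_combination h

theorem shapeEndo_symm (hψ : ∀ x, Cl.form (Q.coord (Q.indexAt x) (ψ x)) = 1)
    (hD : Q.dirac ψ x = -(H • Q.iMul (ψ x)) + τ • Q.iMul (Q.omega (ψ x))) (X Y : T x) :
    inner ℝ (Q.shapeEndo τ ψ (Q.indexAt x) x X) Y =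
      inner ℝ X (Q.shapeEndo τ ψ (Q.indexAt x) x Y) := by
  obtain ⟨b, hb⟩ := exists_orthonormalBasis (orthonormal_frameAt (Q := Q) x)
  rw [← b.sum_inner_mul_inner, ← b.sum_inner_mul_inner]
  simp only [hb, frameAt, Fin.sum_univ_two, real_inner_comm (Q.frame _ _ _) (Q.shapeEndo _ _ _ _ _),
    inner_frame_shapeEndo τ ψ (Q.mem_baseSet_at x), shapeCoeff_symm hψ hD,
    real_inner_comm (Q.frame _ _ _) X]
  ring

theorem trace_shapeEndo (hψ : ∀ x, Cl.form (Q.coord (Q.indexAt x) (ψ x)) = 1)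
    (hD : Q.dirac ψ x = -(H • Q.iMul (ψ x)) + τ • Q.iMul (Q.omega (ψ x))) :
    H = (1 / 2) * LinearMap.trace ℝ (T x)
      (Q.shapeEndo τ ψ (Q.indexAt x) x : T x →ₗ[ℝ] T x) := by
  have he := orthonormal_iff_ite.1 (orthonormal_frameAt (Q := Q) x)
  simp only [frameAt] at he
  rw [trace_eq (orthonormal_frameAt (Q := Q) x)]
  simp only [frameAt, inner_frame_shapeEndo τ ψ (Q.mem_baseSet_at x), Fin.sum_univ_two, he]
  have := shapeCoeff_trace hψ hD
  simp
  linarith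

end Dirac

/-- The endomorphism field determined by a normalized spinor field. It is smooth because near each
point it agrees with its expression in a fixed gauge. -/
def shapeField [IsContMDiffRiemannianBundle (𝓡 2) ∞ E2 (fun x : M ↦ T x)]
    (τ : ℝ) (ψ : Q.SpinorField) (hψ : ∀ x, Cl.form (Q.coord (Q.indexAt x) (ψ x)) = 1) :
    EndoField M where
  toFun x := Q.shapeEndo τ ψ (Q.indexAt x) x
  contMDiff_toFun x := by
    refine (contMDiffAt_shapeEndo τ ψ (Q.mem_baseSet_at x)
      (Cl.normSq_ne_zero (hψ x))).congr_of_eventuallyEq ?_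
    filter_upwards [(Q.isOpen_baseSet _).mem_nhds (Q.mem_baseSet_at x)] with y hy
    rw [shapeEndo_eq τ ψ hψ (Q.mem_baseSet_at y) hy]

end SpinStructure

end Riemannian

end SpinSurface

end

theorem mainTheorem9 {M : Type*} [TopologicalSpace M]
    [ChartedSpace (EuclideanSpace ℝ (Fin 2)) M] [IsManifold (𝓡 2) ∞ M]
    [RiemannianBundle (fun x : M ↦ TangentSpace (𝓡 2) x)]
    [IsContMDiffRiemannianBundle (𝓡 2) ∞ (EuclideanSpace ℝ (Fin 2))
      (fun x : M ↦ TangentSpace (𝓡 2) x)]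
    (o : SpinSurface.SurfaceOrientation M) {ι : Type*} (Q : SpinSurface.SpinStructure o ι)
    (H : M → ℝ) (hH : MDifferentiable (𝓡 2) 𝓘(ℝ, ℝ) H) (τ : ℝ) :
    Set.BijOn Prod.fst (SpinSurface.killingData Q H τ) (SpinSurface.diracData Q H τ) := by
  open SpinSurface SpinStructure in
  refine ⟨?_, ?_, ?_⟩
  · rintro ⟨ψ, S⟩ ⟨hS, hT, hK, hψ⟩
    exact ⟨hψ, fun x ↦ dirac_of_killing (hS x) (hT x) (hK x)⟩
  · rintro ⟨ψ, S⟩ ⟨-, -, hK, hψ⟩ ⟨ψ', S'⟩ ⟨-, -, hK', -⟩ (rfl : ψ = ψ')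
    refine Prod.ext rfl (ContMDiffSection.ext fun x ↦ ContinuousLinearMap.ext fun X ↦ ?_)
    have hx := hψ x
    rw [normSq_plus_sub_normSq_minus] at hx
    exact eq_of_killing hx (hK x X) (hK' x X)
  · rintro ψ ⟨hψ, hD⟩
    simp only [normSq_plus_sub_normSq_minus] at hψ
    refine ⟨(ψ, shapeField τ ψ hψ), ⟨fun x ↦ shapeEndo_symm hψ (hD x),
      fun x ↦ trace_shapeEndo hψ (hD x), fun x ↦ nabla_eq_of_dirac hψ (hD x), fun x ↦ ?_⟩, rfl⟩
    rw [normSq_plus_sub_normSq_minus]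
    exact hψ x
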